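/- For a finitely generated module $M$ over a commutative ring, let $\nu(M)$ be the least number of generators of $M$. If a local ring $B$ is isomorphic to $T/I$ with $T$ a regular local ring and $I\subset T$ an ideal, its complete intersection defect is $\operatorname{cid}(B)=\nu(I)-\operatorname{ht}(I)$. Theorem 16 (Main Theorem). Let $(A,m,k)$ be an equicharacteristic Artinian local ring (i.e. $\operatorname{char}A=\operatorname{char}k$) and let $x_1,\dots,x_n\in m$. Then $A$ and $A/(x_1,\dots,x_n)A$ are both quotients of regular local rings, and, whatever presentations of $A$ and of $A/(x_1,\dots,x_n)A$ as quotients of regular local rings are used to compute the complete intersection defects, the first homology module $H_1(x_1,\dots,x_n;A)$ of the Koszul complex of $x_1,\dots,x_n$ on $A$ satisfies $$\nu\bigl(H_1(x_1,\dots,x_n;A)\bigr)\ \ge\ n+\operatorname{cid}(A)-\operatorname{cid}\bigl(A/(x_1,\dots,x_n)A\bigr).$$ -/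

import Mathlib

universe u v w

/-- The least number of generators of a finitely generated module. -/
noncomputable def leastNumGens (A : Type*) [CommRing A] (M : Type*) [AddCommGroup M]
    [Module A M] : ℕ :=
  (⊤ : Submodule A M).spanFinrank

namespace Koszul

variable {A : Type*} [CommRing A] {n : ℕ}

/-- The differential of the Koszul complex of `x` on the exterior algebra of `Aⁿ`: contraction with
the linear form `v ↦ ∑ i, v i * x i`, that is, the antiderivation with `e i ↦ x i`. -/
noncomputable def differential (x : Fin n → A) :
    ExteriorAlgebra A (Fin n → A) →ₗ[A] ExteriorAlgebra A (Fin n → A) :=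
  CliffordAlgebra.contractLeft (Fintype.linearCombination A x)

/-- The antiderivation rule `d (v ∧ b) = (∑ i, v i * x i) b - v ∧ d b`. -/
theorem differential_ι_mul (x v : Fin n → A) (b : ExteriorAlgebra A (Fin n → A)) :
    differential x (ExteriorAlgebra.ι A v * b) =
      (∑ i, v i * x i) • b - ExteriorAlgebra.ι A v * differential x b := by
  simpa [Fintype.linearCombination_apply, differential] using!
    CliffordAlgebra.contractLeft_ι_mul (Q := (0 : QuadraticForm A (Fin n → A)))
      (Fintype.linearCombination A x) v b

theorem differential_comp_self (x : Fin n → A) (b : ExteriorAlgebra A (Fin n → A)) :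
    differential x (differential x b) = 0 :=
  CliffordAlgebra.contractLeft_contractLeft (Fintype.linearCombination A x) b

theorem exteriorPower_succ (i : ℕ) : (⋀[A]^(i + 1) (Fin n → A)) =
    LinearMap.range (ExteriorAlgebra.ι A : (Fin n → A) →ₗ[A] _) * ⋀[A]^i (Fin n → A) :=
  pow_succ' _ _

/-- The differential lowers the degree by one. -/
theorem differential_mem (x : Fin n → A) (i : ℕ) :
    ∀ b ∈ ⋀[A]^(i + 1) (Fin n → A), differential x b ∈ ⋀[A]^i (Fin n → A) := by
  induction i with
  | zero =>
    intro b hb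
    rw [exteriorPower_succ] at hb
    induction hb using Submodule.mul_induction_on' with
    | mem_mul_mem a ha c hc =>
      obtain ⟨v, rfl⟩ := ha
      obtain ⟨r, rfl⟩ := Submodule.mem_one.1 hc
      have h0 : differential x (algebraMap A _ r) = 0 :=
        CliffordAlgebra.contractLeft_algebraMap _ _ r
      rw [differential_ι_mul, h0, mul_zero, sub_zero]
      exact Submodule.smul_mem _ _ hc
    | add a _ c _ ha hc =>
      rw [map_add]
      exact Submodule.add_mem _ ha hc
  | succ i ih =>
    intro b hb
    rw [exteriorPower_succ] at hb
    induction hb using Submodule.mul_induction_on' with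
    | mem_mul_mem a ha c hc =>
      obtain ⟨v, rfl⟩ := ha
      rw [differential_ι_mul]
      refine Submodule.sub_mem _ (Submodule.smul_mem _ _ hc) ?_
      rw [exteriorPower_succ]
      exact Submodule.mul_mem_mul ⟨v, rfl⟩ (ih c hc)
    | add a _ c _ ha hc =>
      rw [map_add]
      exact Submodule.add_mem _ ha hc

/-- The `i`-cycles of the Koszul complex `K_•(x; A)`, where `K_i(x; A) = ⋀ⁱ Aⁿ`. -/
noncomputable def cycles (x : Fin n → A) (i : ℕ) : Submodule A (ExteriorAlgebra A (Fin n → A)) :=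
  ⋀[A]^i (Fin n → A) ⊓ LinearMap.ker (differential x)

/-- The `i`-boundaries of the Koszul complex `K_•(x; A)`. -/
noncomputable def boundaries (x : Fin n → A) (i : ℕ) :
    Submodule A (ExteriorAlgebra A (Fin n → A)) :=
  (⋀[A]^(i + 1) (Fin n → A)).map (differential x)

theorem boundaries_le_cycles (x : Fin n → A) (i : ℕ) : boundaries x i ≤ cycles x i := by
  rintro _ ⟨b, hb, rfl⟩
  exact ⟨differential_mem x i b hb, differential_comp_self x b⟩

/-- The `i`-th Koszul homology module `H_i(x; A)`: cycles modulo boundaries. -/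
abbrev Homology (x : Fin n → A) (i : ℕ) : Type _ :=
  cycles x i ⧸ (boundaries x i).submoduleOf (cycles x i)

end Koszul

/-- `d` is the complete intersection defect of the local ring `A`, computed from some presentation
`A ≅ T / I` with `T` a regular local ring: `d = ν(I) - ht(I)`. (`I` is a proper ideal of a
Noetherian ring, so that its height is finite and `toNat` loses nothing.) -/
def HasCompleteIntersectionDefect (A : Type u) [CommRing A] (d : ℤ) : Prop :=
  ∃ (T : Type v) (_ : CommRing T) (_ : IsRegularLocalRing T) (f : T →+* A),
    Function.Surjective f ∧
      d = (leastNumGens T (RingHom.ker f) : ℤ) - ((RingHom.ker f).height.toNat : ℤ)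

/-!
The inequality is an exact sequence in degree one of the Koszul complex, once complete intersection
defects are expressed through Koszul homology.

For a linear form `f : F → R` let `KoszulH1 f` be the syzygies `ker f` modulo the Koszul relations
`f u • v - f v • u`. If `T` is a regular local ring with regular parameters `y : Fin r → T`, then
every syzygy of `y` is a Koszul relation (`exists_regularParameters`), and for a surjection
`σ : T → A` with kernel `I` it follows that `KoszulH1` of the images `σ y` has the length of
`I / 𝔪 I`, namely `ν(I)` (`length_koszulH1_of_presentation`). If `A` is Artinian, then moreover
`ht I = dim T = r`, so that the defect computed from `T` is `length KoszulH1 (σ y) - r`. Adjoining a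
redundant element to a generating family of the maximal ideal raises the length of `KoszulH1` by
one (`KoszulH1.length_coprod`); hence `length KoszulH1 y - r` is the same for all finite families
`y` generating the maximal ideal, and the defect does not depend on the presentation.

Now let `y : Fin r → A` generate the maximal ideal and let `ȳ` be its image in `A ⧸ (x)`. The
sequence `KoszulH1 x → KoszulH1 (y, x) → KoszulH1 ȳ → 0` is exact. Its middle term has length
`length KoszulH1 y + n`, and the image of the first map is killed by the maximal ideal, hence has
length at most `ν(KoszulH1 x)`. This gives
`n + length KoszulH1 y ≤ ν(KoszulH1 x) + length KoszulH1 ȳ`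
(`length_koszulH1_coprod_le`), and subtracting `r` on both sides is the claim.

Presentations exist because an equicharacteristic Artinian local ring `A` contains a field mapping
isomorphically onto the residue field: the residue field is formally smooth over its prime field, so
that the identity lifts along the nilpotent maximal ideal (`exists_coefficientField`). Then a
polynomial ring over this field surjects onto `A`, and so does its localization at the preimage of
the maximal ideal, which is regular.
-/

/-! ### Coefficient fields and existence of presentations -/

open Polynomial in
/-- In characteristic `p`, a surjection onto a field with square-zero kernel has a section. A
subring that contains all `p`-th powers and is maximal among those meeting the kernel trivially is a
field. It maps onto `K`: otherwise it could be enlarged by adjoining an element `a`, because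
`X ^ p - a ^ p` is then the minimal polynomial of the image of `a`. -/
theorem exists_section_of_sq_zero_of_charP (p : ℕ) [hp : Fact p.Prime] {B K : Type*} [CommRing B]
    [Field K] [CharP B p] (φ : B →+* K) (hφ : Function.Surjective φ)
    (hsq : RingHom.ker φ ^ 2 = ⊥) : ∃ s : K →+* B, φ.comp s = RingHom.id K := by
  have : CharP K p := by
    have h0 : (p : K) = 0 := by rw [← map_natCast φ, CharP.cast_eq_zero, map_zero]
    have hr : ringChar K = p := ((Nat.dvd_prime hp.out).1 (ringChar.dvd h0)).resolve_left
      CharP.ringChar_ne_one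
    exact ringChar.of_eq hr
  have hker : ∀ b, φ b = 0 → b ^ p = 0 := fun b hb ↦ by
    have h2 : b ^ 2 = 0 := by
      have := Ideal.pow_mem_pow (RingHom.mem_ker.2 hb) 2
      rwa [hsq, Ideal.mem_bot] at this
    exact pow_eq_zero_of_le hp.out.two_le h2
  -- `S` is the set of subrings on which `φ` is injective
  let S : Set (Subring B) := {L | ∀ b ∈ L, φ b = 0 → b = 0}
  have hbase : (frobenius B p).range ∈ S := by
    rintro _ ⟨b, rfl⟩ hb
    rw [frobenius_def, map_pow] at hb
    exact hker b (pow_eq_zero_iff hp.out.ne_zero |>.1 hb)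
  obtain ⟨L, hfrob, hLS, hmax⟩ := zorn_le_nonempty₀ S (fun c hcS hc y hy ↦ by
    refine ⟨sSup c, fun b hb hb0 ↦ ?_, fun z hz ↦ le_sSup hz⟩
    rw [Subring.mem_sSup_of_directedOn ⟨y, hy⟩ hc.directedOn] at hb
    obtain ⟨M, hM, hbM⟩ := hb
    exact hcS hM b hbM hb0) _ hbase
  have hpow : ∀ b : B, b ^ p ∈ L := fun b ↦ hfrob ⟨b, rfl⟩
  let ψ : L →+* K := φ.comp L.subtype
  have hψ : Function.Injective ψ := (injective_iff_map_eq_zero ψ).2 fun b hb ↦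
    Subtype.ext (hLS b b.2 hb)
  have hfield : IsField L := by
    refine ⟨⟨0, 1, fun h ↦ zero_ne_one (α := K) (by simpa using congrArg ψ h)⟩, mul_comm,
      fun {b} hb ↦ ?_⟩
    have hb' : ψ b ≠ 0 := fun h ↦ hb (hψ (by rw [h, map_zero]))
    obtain ⟨c, hc⟩ := hφ (ψ b)⁻¹
    refine ⟨b ^ (p - 1) * ⟨c ^ p, hpow c⟩, hψ ?_⟩
    have hcp : ψ ⟨c ^ p, hpow c⟩ = (ψ b)⁻¹ ^ p := by
      change φ (c ^ p) = _
      rw [map_pow, hc]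
    rw [← mul_assoc, mul_pow_sub_one hp.out.ne_zero, map_mul, map_pow, hcp, ← mul_pow,
      mul_inv_cancel₀ hb', one_pow, map_one]
  let _ : Field L := hfield.toField
  have hsurj : Function.Surjective ψ := by
    intro y
    obtain ⟨a, rfl⟩ := hφ y
    by_contra hna
    let _ : Algebra L K := ψ.toAlgebra
    let q : L[X] := X ^ p - C ⟨a ^ p, hpow a⟩
    have hirr : Irreducible q := X_pow_sub_C_irreducible_of_prime hp.out fun b hb ↦ hna ⟨b, by
      have h1 : ψ b ^ p = φ a ^ p := by
        rw [← map_pow, hb]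
        exact map_pow φ a p
      exact frobenius_inj K p h1⟩
    have hq : q = minpoly L (φ a) := minpoly.eq_of_irreducible_of_monic hirr (by
      rw [map_sub, map_pow, aeval_X, aeval_C, sub_eq_zero]
      exact (map_pow φ a p).symm) (monic_X_pow_sub_C _ hp.out.ne_zero)
    let ev : L[X] →+* B := eval₂RingHom L.subtype a
    have hevq : ev q = 0 := by simp [ev, q]
    have hS : ev.range ∈ S := by
      rintro _ ⟨f, rfl⟩ hf
      have : aeval (φ a) f = 0 := by
        rw [← hf]
        simp only [ev, coe_eval₂RingHom, hom_eval₂]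
        rfl
      obtain ⟨g, rfl⟩ := hq ▸ minpoly.dvd L (φ a) this
      rw [map_mul, hevq, zero_mul]
    have hle : L ≤ ev.range := fun b hb ↦ ⟨C ⟨b, hb⟩, by simp [ev]⟩
    exact hna ⟨⟨a, hmax hS hle ⟨X, by simp [ev]⟩⟩, rfl⟩
  let e := RingEquiv.ofBijective ψ ⟨hψ, hsurj⟩
  exact ⟨L.subtype.comp e.symm.toRingHom, RingHom.ext fun y ↦ e.apply_symm_apply y⟩

/-- A field of characteristic `p`, finitely generated or not, is formally smooth over its prime
field. -/
theorem formallySmooth_zmod_of_field (p : ℕ) [hp : Fact p.Prime] (K : Type*) [Field K]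
    [Algebra (ZMod p) K] :
    Algebra.FormallySmooth (ZMod p) K := by
  let f : MvPolynomial K (ZMod p) →ₐ[ZMod p] K := MvPolynomial.aeval id
  have hf : Function.Surjective f := fun x ↦ ⟨.X x, by simp [f]⟩
  rw [Algebra.FormallySmooth.iff_split_surjection f hf]
  have hsurj : Function.Surjective f.kerSquareLift :=
    Ideal.Quotient.lift_surjective_of_surjective _ _ hf
  have hsq : RingHom.ker f.kerSquareLift.toRingHom ^ 2 = ⊥ := by
    rw [AlgHom.ker_kerSquareLift, Ideal.cotangentIdeal_square]
  have : Nontrivial (MvPolynomial K (ZMod p) ⧸ RingHom.ker f.toRingHom ^ 2) :=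
    f.kerSquareLift.toRingHom.domain_nontrivial
  have : CharP (MvPolynomial K (ZMod p) ⧸ RingHom.ker f.toRingHom ^ 2) p :=
    charP_of_injective_algebraMap (algebraMap (ZMod p) _).injective p
  obtain ⟨s, hs⟩ := exists_section_of_sq_zero_of_charP p f.kerSquareLift.toRingHom hsurj hsq
  refine ⟨⟨s, fun r ↦ ?_⟩, AlgHom.ext fun x ↦ congr($hs x)⟩
  exact congr($(Subsingleton.elim (s.comp (algebraMap (ZMod p) K)) (algebraMap (ZMod p) _)) r)

/-- A field of characteristic zero is separably generated, hence formally smooth, over `ℚ`. -/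
theorem formallySmooth_rat_of_field (K : Type*) [Field K] [Algebra ℚ K] :
    Algebra.FormallySmooth ℚ K := by
  obtain ⟨s, hs⟩ := exists_isTranscendenceBasis ℚ K
  have : Algebra.IsAlgebraic (IntermediateField.adjoin ℚ (Set.range ((↑) : s → K))) K :=
    hs.isAlgebraic_field
  exact .of_algebraicIndependent_of_isSeparable hs.1

open IsLocalRing in
/-- An equicharacteristic Artinian local ring has a coefficient field. -/
theorem exists_coefficientField (A : Type*) [CommRing A] [IsLocalRing A] [IsArtinianRing A]
    (hA : ringChar A = ringChar (ResidueField A)) :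
    ∃ s : ResidueField A →+* A, (residue A).comp s = RingHom.id _ := by
  have hnil : IsNilpotent (maximalIdeal A) :=
    (isArtinianRing_iff_isNilpotent_maximalIdeal A).1 inferInstance
  have lift (F : Type) [Field F] [Algebra F A]
      (_ : Algebra.FormallySmooth F (ResidueField A)) :
      ∃ s : ResidueField A →+* A, (residue A).comp s = RingHom.id _ := by
    obtain ⟨s, hs⟩ := Algebra.FormallySmooth.exists_lift (R := F) (maximalIdeal A) hnil
      (AlgHom.id F (ResidueField A))
    exact ⟨s, RingHom.ext fun x ↦ congr($hs x)⟩
  rcases CharP.exists' (ResidueField A) with h0 | ⟨p, hp, hpc⟩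
  · -- every proper quotient of `A` maps onto the residue field, hence has characteristic zero
    obtain ⟨_⟩ := (EqualCharZero.nonempty_algebraRat_iff A).2 fun I hI ↦
      have : CharZero (A ⧸ maximalIdeal A) := h0
      (Ideal.Quotient.factor (le_maximalIdeal hI)).charZero
    exact lift ℚ (by
      -- the two `ℚ`-algebra structures on the residue field agree, but not by unfolding
      convert! formallySmooth_rat_of_field (ResidueField A)
      exact Subsingleton.elim _ _)
  · have hr : ringChar (ResidueField A) = p := ringChar.eq_iff.2 inferInstance
    have : CharP A p := ringChar.of_eq (hA.trans hr)
    let _ : Algebra (ZMod p) A := ZMod.algebra A p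
    exact lift (ZMod p) (formallySmooth_zmod_of_field p _)

open IsLocalRing MvPolynomial in
/-- An equicharacteristic Artinian local ring is a quotient of a regular local ring, namely of a
localization of a polynomial ring over a coefficient field. -/
theorem exists_surjective_of_isRegularLocalRing (A : Type u) [CommRing A] [IsLocalRing A]
    [IsArtinianRing A] (hA : ringChar A = ringChar (ResidueField A)) :
    ∃ (T : Type u) (_ : CommRing T) (_ : IsRegularLocalRing T) (f : T →+* A),
      Function.Surjective f := by
  obtain ⟨s, hs⟩ := exists_coefficientField A hA
  obtain ⟨r, y, hy⟩ := Submodule.fg_iff_exists_fin_generating_family.1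
    (maximalIdeal A).fg_of_isNoetherianRing
  let ev : MvPolynomial (Fin r) (ResidueField A) →+* A := eval₂Hom s y
  let P := (maximalIdeal A).comap ev
  have hunit (t : P.primeCompl) : IsUnit (ev t) := by
    by_contra h
    exact t.2 ((mem_maximalIdeal _).2 h)
  have hev : Function.Surjective ev := by
    -- successive approximation: every element is a polynomial in `y` modulo each power of the
    -- maximal ideal, and some power vanishes
    have key (n : ℕ) : ∀ a, ∃ q, a - ev q ∈ maximalIdeal A ^ n := by
      induction n with
      | zero => simp
      | succ n ih =>
        intro a
        have ha : a - s (residue A a) ∈ maximalIdeal A := by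
          rw [← residue_eq_zero_iff, map_sub, sub_eq_zero]
          exact congr($hs (residue A a)).symm
        rw [← hy, Submodule.mem_span_range_iff_exists_fun] at ha
        obtain ⟨c, hc⟩ := ha
        choose q hq using fun i ↦ ih (c i)
        refine ⟨C (residue A a) + ∑ i, q i * X i, ?_⟩
        have h1 : a - ev (C (residue A a) + ∑ i, q i * X i) = ∑ i, (c i - ev (q i)) * y i := by
          simp only [map_add, map_sum, map_mul, ev, coe_eval₂Hom, eval₂_C, eval₂_X, sub_mul,
            Finset.sum_sub_distrib]
          rw [← sub_sub, ← hc]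
          rfl
        rw [h1, pow_succ]
        exact Submodule.sum_mem _ fun i _ ↦ Ideal.mul_mem_mul (hq i)
          (hy ▸ Submodule.subset_span ⟨i, rfl⟩)
    intro a
    obtain ⟨n, hn⟩ := (isArtinianRing_iff_isNilpotent_maximalIdeal A).1 inferInstance
    obtain ⟨q, hq⟩ := key n a
    rw [hn, Ideal.zero_eq_bot, Ideal.mem_bot, sub_eq_zero] at hq
    exact ⟨q, hq.symm⟩
  refine ⟨Localization.AtPrime P, inferInstance, inferInstance,
    IsLocalization.lift (M := P.primeCompl) hunit, fun a ↦ ?_⟩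
  obtain ⟨q, rfl⟩ := hev a
  exact ⟨algebraMap _ _ q, IsLocalization.lift_eq _ _⟩

/-! ### Lengths and numbers of generators -/

open IsLocalRing

/-- The length of the target of a surjective map that is semilinear along a surjection of rings. -/
theorem length_quotient_ker_of_surjective {R S M N : Type*} [CommRing R] [CommRing S]
    {σ : R →+* S} (hσ : Function.Surjective σ) [AddCommGroup M] [Module R M] [AddCommGroup N]
    [Module S N] (α : M →ₛₗ[σ] N) (hα : Function.Surjective α) :
    Module.length R (M ⧸ LinearMap.ker α) = Module.length S N := by
  let _ : Algebra R S := σ.toAlgebra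
  let _ : Module R N := Module.compHom N σ
  have : IsScalarTower R S N := ⟨fun a b c ↦ mul_smul (σ a) b c⟩
  let α' : M →ₗ[R] N := { toFun := α, map_add' := α.map_add, map_smul' := α.map_smulₛₗ }
  rw [← Module.length_eq_of_surjective (S := R) (R := S) hσ]
  exact (α'.quotKerEquivOfSurjective hα).length_eq

theorem length_eq_length_ker_add {R S M N : Type*} [CommRing R] [CommRing S]
    {σ : R →+* S} (hσ : Function.Surjective σ) [AddCommGroup M] [Module R M] [AddCommGroup N]
    [Module S N] (α : M →ₛₗ[σ] N) (hα : Function.Surjective α) :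
    Module.length R M = Module.length R (LinearMap.ker α) + Module.length S N := by
  rw [← length_quotient_ker_of_surjective hσ α hα]
  exact Module.length_eq_add_of_exact _ _ (Submodule.subtype_injective _)
    (Submodule.mkQ_surjective _) (LinearMap.exact_subtype_mkQ _)

/-- Nakayama: `N / 𝔪 N` has length the least number of generators of `N`. -/
theorem length_quotient_maximalIdeal_smul {R M : Type*} [CommRing R] [IsLocalRing R]
    [AddCommGroup M] [Module R M] (N : Submodule R M) (hN : N.FG) :
    Module.length R (N ⧸ maximalIdeal R • (⊤ : Submodule R N)) = N.spanFinrank := by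
  have : Module.Finite R N := Module.Finite.iff_fg.2 hN
  have : Module.Finite R (N ⧸ maximalIdeal R • (⊤ : Submodule R N)) := inferInstance
  let _ : Field (R ⧸ maximalIdeal R) := Ideal.Quotient.field _
  have : Module.Finite (R ⧸ maximalIdeal R) (N ⧸ maximalIdeal R • (⊤ : Submodule R N)) :=
    Module.Finite.of_restrictScalars_finite R _ _
  rw [spanFinrank_eq_finrank_quotient N hN,
    Module.length_eq_of_surjective (S := R) (R := R ⧸ maximalIdeal R) Ideal.Quotient.mk_surjective,
    Module.length_eq_finrank]

/-- A submodule killed by the maximal ideal is a vector space over the residue field, of dimension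
its least number of generators. -/
theorem length_eq_spanFinrank {R M : Type*} [CommRing R] [IsLocalRing R]
    [AddCommGroup M] [Module R M] (N : Submodule R M) (hN : N.FG)
    (h : ∀ a ∈ maximalIdeal R, ∀ v ∈ N, a • v = 0) : Module.length R N = N.spanFinrank := by
  rw [← length_quotient_maximalIdeal_smul N hN]
  have : maximalIdeal R • (⊤ : Submodule R N) = ⊥ := by
    rw [eq_bot_iff, Submodule.smul_le]
    rintro a ha v -
    exact (Submodule.mem_bot R).2 (Subtype.ext (h a ha v v.2))
  exact ((Submodule.quotEquivOfEq _ _ this).trans (Submodule.quotEquivOfEqBot ⊥ rfl)).length_eq.symm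

/-! ### First Koszul homology of a linear form -/

section KoszulH1

variable {R S F G : Type*} [CommRing R] [CommRing S] [AddCommGroup F] [AddCommGroup G]
  [Module R F] [Module S G]

/-- The Koszul relations `f u • v - f v • u` between the values of a linear form `f`. For the form
`∑ i, v i * x i` on `Rⁿ` they are the boundaries of degree one in the Koszul complex of `x`. -/
def koszulRelations (f : F →ₗ[R] R) : Submodule R F :=
  Submodule.span R {w | ∃ u v, f u • v - f v • u = w}

/-- The first Koszul homology of a linear form: its kernel modulo the Koszul relations. Working with
forms on arbitrary modules lets families be concatenated by `LinearMap.coprod`. -/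
abbrev KoszulH1 (f : F →ₗ[R] R) : Type _ :=
  LinearMap.ker f ⧸ (koszulRelations f).submoduleOf (LinearMap.ker f)

theorem smul_sub_smul_mem_koszulRelations (f : F →ₗ[R] R) (u v : F) :
    f u • v - f v • u ∈ koszulRelations f :=
  Submodule.subset_span ⟨u, v, rfl⟩

theorem koszulRelations_le_ker (f : F →ₗ[R] R) : koszulRelations f ≤ LinearMap.ker f := by
  refine Submodule.span_le.2 ?_
  rintro _ ⟨u, v, rfl⟩
  simp [mul_comm]

/-- The values of `f` annihilate its first Koszul homology. -/
theorem smul_mem_koszulRelations (f : F →ₗ[R] R) {a : R} (ha : a ∈ LinearMap.range f) {v : F}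
    (hv : f v = 0) : a • v ∈ koszulRelations f := by
  obtain ⟨u, rfl⟩ := ha
  simpa [hv] using smul_sub_smul_mem_koszulRelations f u v

variable {σ : R →+* S} {f : F →ₗ[R] R} {g : G →ₗ[S] S} (φ : F →ₛₗ[σ] G)

theorem map_mem_koszulRelations (h : ∀ v, g (φ v) = σ (f v)) {w : F} (hw : w ∈ koszulRelations f) :
    φ w ∈ koszulRelations g := by
  refine (Submodule.span_le (p := (koszulRelations g).comap φ)).2 ?_ hw
  rintro _ ⟨u, v, rfl⟩
  simpa [h] using smul_sub_smul_mem_koszulRelations g (φ u) (φ v)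

theorem exists_mem_koszulRelations_map_eq (hσ : Function.Surjective σ)
    (h : ∀ v, g (φ v) = σ (f v)) (hφ : Function.Surjective φ)
    {w : G} (hw : w ∈ koszulRelations g) : ∃ v ∈ koszulRelations f, φ v = w := by
  have : RingHomSurjective σ := ⟨hσ⟩
  refine (Submodule.span_le (p := (koszulRelations f).map φ)).2 ?_ hw
  rintro _ ⟨u, v, rfl⟩
  obtain ⟨u, rfl⟩ := hφ u
  obtain ⟨v, rfl⟩ := hφ v
  exact ⟨_, smul_sub_smul_mem_koszulRelations f u v, by simp [h]⟩

namespace KoszulH1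

/-- The class of a syzygy in the first Koszul homology. -/
def mk (f : F →ₗ[R] R) : LinearMap.ker f →ₗ[R] KoszulH1 f := Submodule.mkQ _

theorem mk_surjective (f : F →ₗ[R] R) : Function.Surjective (mk f) := Submodule.mkQ_surjective _

theorem mk_eq_zero {v : LinearMap.ker f} : mk f v = 0 ↔ (v : F) ∈ koszulRelations f :=
  Submodule.Quotient.mk_eq_zero _

theorem mk_eq_mk {v w : LinearMap.ker f} :
    mk f v = mk f w ↔ (v : F) - w ∈ koszulRelations f := by
  rw [← sub_eq_zero, ← map_sub, mk_eq_zero]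
  rfl

theorem smul_eq_zero {a : R} (ha : a ∈ LinearMap.range f) (c : KoszulH1 f) : a • c = 0 := by
  obtain ⟨v, rfl⟩ := mk_surjective f c
  rw [← map_smul, mk_eq_zero]
  exact smul_mem_koszulRelations f ha v.2

/-- The semilinear map on first Koszul homology induced by a semilinear map compatible with the
forms. -/
def map (h : ∀ v, g (φ v) = σ (f v)) : KoszulH1 f →ₛₗ[σ] KoszulH1 g :=
  Submodule.mapQ _ _ ((φ.comp (LinearMap.ker f).subtype).codRestrict (LinearMap.ker g)
    fun v ↦ by simp [h]) fun _ hv ↦ map_mem_koszulRelations φ h hv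

theorem map_mk (h : ∀ v, g (φ v) = σ (f v)) (v : LinearMap.ker f) :
    map φ h (mk f v) = mk g ⟨φ v, by simp [h]⟩ := rfl

end KoszulH1

end KoszulH1

/-- Membership of `ψ a` can be tested on the summands `a i • ψ eᵢ`, where `eᵢ` are the unit
vectors. -/
theorem map_mem_of_forall_smul_mem {R M : Type*} [CommRing R] [AddCommGroup M] [Module R M]
    {ι : Type*} [Finite ι] (ψ : (ι → R) →ₗ[R] M) (N : Submodule R M) {a : ι → R}
    (h : ∀ i w, a i • ψ w ∈ N) : ψ a ∈ N := by
  classical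
  have := Fintype.ofFinite ι
  rw [LinearMap.pi_apply_eq_sum_univ ψ a]
  exact Submodule.sum_mem _ fun i _ ↦ h i _

/-- Apply `σ` to each coordinate. -/
def mapCoord {R S : Type*} [CommRing R] [CommRing S] (σ : R →+* S) (ι : Type*) :
    (ι → R) →ₛₗ[σ] (ι → S) where
  toFun v i := σ (v i)
  map_add' v w := by ext; simp
  map_smul' a v := by ext; simp

theorem mapCoord_surjective {R S : Type*} [CommRing R] [CommRing S] {σ : R →+* S}
    (hσ : Function.Surjective σ) (ι : Type*) : Function.Surjective (mapCoord σ ι) := fun c ↦ by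
  choose v hv using fun i ↦ hσ (c i)
  exact ⟨v, funext hv⟩

theorem linearCombination_mapCoord {R S : Type*} [CommRing R] [CommRing S] (σ : R →+* S)
    {ι : Type*} [Fintype ι] (y : ι → R) (v : ι → R) :
    Fintype.linearCombination S (σ ∘ y) (mapCoord σ ι v) =
      σ (Fintype.linearCombination R y v) := by
  simp [mapCoord, Fintype.linearCombination_apply]

/-! ### Redundant generators -/

section Coprod

variable {R F G : Type*} [CommRing R] [AddCommGroup F] [AddCommGroup G]
  [Module R F] [Module R G]

namespace KoszulH1

theorem length_congr {f : F →ₗ[R] R} {g : G →ₗ[R] R} (e : F ≃ₗ[R] G) (h : ∀ v, g (e v) = f v) :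
    Module.length R (KoszulH1 f) = Module.length R (KoszulH1 g) := by
  have h' : ∀ v, f (e.symm v) = g v := fun v ↦ by rw [← h, e.apply_symm_apply]
  refine (LinearEquiv.ofLinearMap (map (g := g) e.toLinearMap h)
    (map (f := g) e.symm.toLinearMap h') ?_ ?_).length_eq
  · refine LinearMap.ext fun c ↦ ?_
    obtain ⟨v, rfl⟩ := mk_surjective g c
    simp [map_mk]
  · refine LinearMap.ext fun c ↦ ?_
    obtain ⟨v, rfl⟩ := mk_surjective f c
    simp [map_mk]

theorem length_coprod_comm (f : F →ₗ[R] R) (g : G →ₗ[R] R) :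
    Module.length R (KoszulH1 (f.coprod g)) = Module.length R (KoszulH1 (g.coprod f)) :=
  length_congr (LinearEquiv.prodComm R F G) fun v ↦ by simp [add_comm]

/-- If `f` already has the maximal ideal as its range, then `s` further elements of the maximal
ideal add `s` to the length of the first Koszul homology: the sequence
`0 → KoszulH1 f → KoszulH1 (f.coprod g) → (R ⧸ 𝔪)ˢ → 0` is exact, where the second map reduces the
coefficients of the further elements. -/
theorem length_coprod [IsLocalRing R] (f : F →ₗ[R] R) (hf : LinearMap.range f = maximalIdeal R)
    {s : ℕ} (g : (Fin s → R) →ₗ[R] R) (hg : LinearMap.range g ≤ maximalIdeal R) :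
    Module.length R (KoszulH1 (f.coprod g)) = Module.length R (KoszulH1 f) + s := by
  obtain ⟨B, hB⟩ : ∃ B : (Fin s → R) →ₗ[R] F, ∀ v, f (B v) = g v := by
    choose b hb using fun i ↦ (hf ▸ hg) ⟨Pi.single i 1, rfl⟩
    refine ⟨Fintype.linearCombination R b, fun v ↦ ?_⟩
    rw [← LinearMap.comp_apply]
    congr 1
    exact LinearMap.pi_ext' fun i ↦ LinearMap.ext_ring (by simp [hb])
  have hinl : ∀ v, (f.coprod g) (LinearMap.inl R F (Fin s → R) v) = f v := by simp
  let ι := map (f := f) (g := f.coprod g) (LinearMap.inl R F (Fin s → R)) hinl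
  -- rewriting the redundant elements by means of `f` gives a retraction of the first map
  let ρ : F × (Fin s → R) →ₗ[R] F := LinearMap.id.coprod B
  have hρ : ∀ v, f (ρ v) = (f.coprod g) v := fun v ↦ by simp [ρ, hB]
  let π₀ : (Fin s → R) →ₗ[R] (Fin s → R ⧸ maximalIdeal R) := (maximalIdeal R).mkQ.compLeft (Fin s)
  have hπ₀ (a : Fin s → R) : π₀ a = 0 ↔ ∀ i, a i ∈ maximalIdeal R := by
    rw [funext_iff]
    exact forall_congr' fun i ↦ Submodule.Quotient.mk_eq_zero _
  let π₁ : LinearMap.ker (f.coprod g) →ₗ[R] (Fin s → R ⧸ maximalIdeal R) :=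
    π₀ ∘ₗ LinearMap.snd R F _ ∘ₗ Submodule.subtype _
  let π : KoszulH1 (f.coprod g) →ₗ[R] (Fin s → R ⧸ maximalIdeal R) :=
    Submodule.liftQ _ π₁ (by
      rintro ⟨v, hv⟩ hv'
      have hle : koszulRelations (f.coprod g) ≤ LinearMap.ker (π₀ ∘ₗ LinearMap.snd R F _) := by
        refine Submodule.span_le.2 ?_
        rintro _ ⟨u, w, rfl⟩
        have hm (u) : f.coprod g u ∈ maximalIdeal R := by
          rw [LinearMap.coprod_apply]
          exact add_mem (hf ▸ LinearMap.mem_range_self f _) (hg (LinearMap.mem_range_self g _))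
        exact (hπ₀ _).2 fun i ↦ sub_mem (Ideal.mul_mem_right _ _ (hm u))
          (Ideal.mul_mem_right _ _ (hm w))
      exact hle hv')
  have hι : Function.Injective ι := by
    refine Function.LeftInverse.injective (g := map ρ hρ) fun c ↦ ?_
    obtain ⟨v, rfl⟩ := mk_surjective f c
    simp [ι, map_mk, ρ]
  have hπ : Function.Surjective π := by
    intro c
    choose a ha using fun i ↦ Submodule.mkQ_surjective _ (c i)
    refine ⟨mk _ ⟨(- B a, a), by simp [hB]⟩, funext ha⟩
  have hex : Function.Exact ι π := by
    intro c
    obtain ⟨⟨⟨b, a⟩, hv⟩, rfl⟩ := mk_surjective _ c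
    have hπmk : π (mk _ ⟨(b, a), hv⟩) = π₀ a := rfl
    rw [hπmk, hπ₀]
    refine ⟨fun ha ↦ ?_, ?_⟩
    · -- `(-B a, a)` is a combination of cycles with coefficients `a i` in the maximal ideal
      have hba : f b + g a = 0 := hv
      refine ⟨mk f ⟨b + B a, by simpa [hB] using hba⟩, mk_eq_mk.2 ?_⟩
      have hrel : ((-B).prod LinearMap.id) a ∈ koszulRelations (f.coprod g) :=
        map_mem_of_forall_smul_mem _ _ fun i w ↦ smul_mem_koszulRelations _ (by
          rw [LinearMap.range_coprod, hf]
          exact Submodule.mem_sup_left (ha i)) (by simp [hB])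
      change (b + B a, (0 : Fin s → R)) - (b, a) ∈ _
      simpa using neg_mem hrel
    · rintro ⟨d, hd⟩
      obtain ⟨w, rfl⟩ := mk_surjective f d
      have h0 : π₀ 0 = π₀ a := congrArg π hd
      exact (hπ₀ a).1 (by rw [← h0, map_zero])
  rw [Module.length_eq_add_of_exact ι π hι hπ hex, Module.length_pi_of_fintype]
  have : IsSimpleModule R (R ⧸ maximalIdeal R) :=
    isSimpleModule_iff_isCoatom.2 (maximalIdeal.isMaximal R).out
  simp

/-- The length of the first Koszul homology minus the number of elements is the same for all finite
families generating the maximal ideal. -/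
theorem length_add_eq [IsLocalRing R] {r s : ℕ} (f : (Fin r → R) →ₗ[R] R)
    (hf : LinearMap.range f = maximalIdeal R)
    (g : (Fin s → R) →ₗ[R] R) (hg : LinearMap.range g = maximalIdeal R) :
    Module.length R (KoszulH1 f) + s = Module.length R (KoszulH1 g) + r := by
  rw [← length_coprod f hf g hg.le, ← length_coprod g hg f hf.le, length_coprod_comm]

end KoszulH1

end Coprod

open Fintype (linearCombination)

/-! ### Passing to a quotient ring -/

section Quotient

variable {A : Type*} [CommRing A] {n r : ℕ}

/-- Exactness of `KoszulH1 x → KoszulH1 (y, x) → KoszulH1 ȳ → 0`, where `ȳ` is the image of `y`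
modulo `x`, bounds the length of the middle term; the image of the first map is killed by the
maximal ideal, so that its length is at most the number of generators of `KoszulH1 x`. -/
theorem length_koszulH1_coprod_le [IsLocalRing A] [IsNoetherianRing A] (x : Fin n → A)
    (y : Fin r → A) (hy : Ideal.span (Set.range y) = maximalIdeal A) :
    Module.length A (KoszulH1 ((linearCombination A y).coprod (linearCombination A x))) ≤
      leastNumGens A (KoszulH1 (linearCombination A x)) +
      Module.length (A ⧸ Ideal.span (Set.range x)) (KoszulH1 (linearCombination
        (A ⧸ Ideal.span (Set.range x)) (Ideal.Quotient.mk (Ideal.span (Set.range x)) ∘ y))) := by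
  set J := Ideal.span (Set.range x)
  set p := linearCombination A x
  set q := linearCombination A y
  set q' := linearCombination (A ⧸ J) (Ideal.Quotient.mk J ∘ y)
  let φ₀ := mapCoord (Ideal.Quotient.mk J) (Fin r)
  have hφ₀ : Function.Surjective φ₀ := mapCoord_surjective Ideal.Quotient.mk_surjective _
  have hq (v) : q' (φ₀ v) = Ideal.Quotient.mk J (q v) := linearCombination_mapCoord _ y v
  have hpJ : LinearMap.range p = J := Fintype.range_linearCombination A x
  have hp (v) : Ideal.Quotient.mk J (p v) = 0 :=
    Ideal.Quotient.eq_zero_iff_mem.2 (hpJ ▸ LinearMap.mem_range_self p v)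
  let φ : (Fin r → A) × (Fin n → A) →ₛₗ[Ideal.Quotient.mk J] (Fin r → A ⧸ J) :=
    φ₀.comp (LinearMap.fst A _ _)
  have hφ (v) : q' (φ v) = Ideal.Quotient.mk J (q.coprod p v) := by
    simp [φ, hq, hp]
  let α := KoszulH1.map φ hφ
  have hα : Function.Surjective α := by
    intro c
    obtain ⟨⟨w, hw⟩, rfl⟩ := KoszulH1.mk_surjective _ c
    obtain ⟨v, rfl⟩ := hφ₀ w
    rw [LinearMap.mem_ker, hq, Ideal.Quotient.eq_zero_iff_mem, ← hpJ] at hw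
    obtain ⟨u, hu⟩ := hw
    exact ⟨KoszulH1.mk _ ⟨(v, -u), by simp [hu]⟩, rfl⟩
  let ι : KoszulH1 p →ₗ[A] KoszulH1 (q.coprod p) :=
    KoszulH1.map (f := p) (g := q.coprod p) (LinearMap.inr A (Fin r → A) (Fin n → A)) (by simp)
  have hker : LinearMap.ker α = LinearMap.range ι := by
    ext c
    obtain ⟨⟨⟨b, a⟩, hv⟩, rfl⟩ := KoszulH1.mk_surjective _ c
    constructor
    · intro hc
      obtain ⟨w, hw, hwb⟩ := exists_mem_koszulRelations_map_eq φ₀ Ideal.Quotient.mk_surjective hq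
        hφ₀ (KoszulH1.mk_eq_zero.1 hc)
      have hJ (i) : (b - w) i ∈ J := by
        rw [← Ideal.Quotient.eq_zero_iff_mem, Pi.sub_apply, map_sub, sub_eq_zero]
        exact (congrFun hwb i).symm
      -- modulo Koszul relations, coordinates in the range of `p` can be moved to the second factor
      obtain ⟨⟨b', u⟩, hu, hb'⟩ : b - w ∈ (koszulRelations (q.coprod p)).map
          (LinearMap.fst A (Fin r → A) (Fin n → A)) := by
        refine map_mem_of_forall_smul_mem (LinearMap.id (M := Fin r → A)) _ fun i e ↦ ?_
        obtain ⟨t, ht⟩ : (b - w) i ∈ LinearMap.range p := hpJ ▸ hJ i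
        exact ⟨_, smul_sub_smul_mem_koszulRelations (q.coprod p) (0, t) (e, 0),
          (show _ = p t • e by simp).trans (by rw [ht]; rfl)⟩
      have hbu : (b, u) ∈ koszulRelations (q.coprod p) := by
        have hw' := map_mem_koszulRelations (f := q) (g := q.coprod p)
          (LinearMap.inl A (Fin r → A) (Fin n → A)) (by simp) hw
        convert! add_mem hu hw' using 1
        simp [show b' = b - w from hb']
      have hpa : p (a - u) = 0 := by
        have h1 : q b + p a = 0 := hv
        have h2 : q b + p u = 0 := koszulRelations_le_ker _ hbu
        rw [map_sub, sub_eq_zero]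
        exact add_left_cancel (h1.trans h2.symm)
      refine ⟨KoszulH1.mk p ⟨a - u, hpa⟩, KoszulH1.mk_eq_mk.2 ?_⟩
      change ((0 : Fin r → A), a - u) - (b, a) ∈ _
      simpa using neg_mem hbu
    · rintro ⟨d, hd⟩
      obtain ⟨w, rfl⟩ := KoszulH1.mk_surjective p d
      rw [← hd]
      refine KoszulH1.mk_eq_zero.2 ?_
      change φ₀ 0 ∈ _
      rw [map_zero]
      exact zero_mem _
  rw [length_eq_length_ker_add Ideal.Quotient.mk_surjective α hα, hker]
  gcongr
  rw [length_eq_spanFinrank _ (IsNoetherian.noetherian _)]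
  · rw [LinearMap.range_eq_map, leastNumGens]
    exact_mod_cast Submodule.spanFinrank_map_le_of_fg _ (IsNoetherian.noetherian _)
  · intro a ha c _
    refine KoszulH1.smul_eq_zero ?_ c
    rw [LinearMap.range_coprod, Fintype.range_linearCombination]
    exact Submodule.mem_sup_left (by rw [← hy] at ha; exact ha)

/-- For a surjection `σ : T → A` with kernel `I` and generators `y` of the maximal ideal of `T`
whose syzygies are all Koszul relations, `KoszulH1 (σ y)` has the length of `I / 𝔪 I`. Both are
quotients of the module `P` of vectors `v` with `∑ i, v i * y i ∈ I`, by the same submodule. -/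
theorem length_koszulH1_of_presentation {T : Type*} [CommRing T] [IsLocalRing T]
    [IsNoetherianRing T] [IsLocalRing A] (σ : T →+* A) (hσ : Function.Surjective σ) (y : Fin r → T)
    (hy : Ideal.span (Set.range y) = maximalIdeal T)
    (hy' : LinearMap.ker (linearCombination T y) ≤ koszulRelations (linearCombination T y)) :
    Module.length A (KoszulH1 (linearCombination A (σ ∘ y))) = leastNumGens T (RingHom.ker σ) := by
  set I := RingHom.ker σ
  set f := linearCombination T y
  set g := linearCombination A (σ ∘ y)
  let φ := mapCoord σ (Fin r)
  have hφ : Function.Surjective φ := mapCoord_surjective hσ _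
  have hg (v) : g (φ v) = σ (f v) := linearCombination_mapCoord _ y v
  have hfm : LinearMap.range f = maximalIdeal T :=
    (Fintype.range_linearCombination T y).trans hy
  let P : Submodule T (Fin r → T) := Submodule.comap f I
  let α₀ : P →ₛₗ[σ] LinearMap.ker g := (φ.comp P.subtype).codRestrict _ fun v ↦ by
    rw [LinearMap.mem_ker, LinearMap.comp_apply, hg]
    exact v.2
  let α : P →ₛₗ[σ] KoszulH1 g := (KoszulH1.mk g).comp α₀
  have hα : Function.Surjective α := by
    intro c
    obtain ⟨⟨w, hw⟩, rfl⟩ := KoszulH1.mk_surjective _ c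
    obtain ⟨v, rfl⟩ := hφ w
    exact ⟨⟨v, (hg v).symm.trans hw⟩, rfl⟩
  let β₀ : P →ₗ[T] I := (f.comp P.subtype).codRestrict I fun v ↦ v.2
  let β := (maximalIdeal T • (⊤ : Submodule T I)).mkQ.comp β₀
  have hβ : Function.Surjective β := by
    refine (Submodule.mkQ_surjective _).comp fun i ↦ ?_
    obtain ⟨v, hv⟩ : (i : T) ∈ LinearMap.range f :=
      hfm ▸ le_maximalIdeal (RingHom.ker_ne_top σ) i.2
    exact ⟨⟨v, by simp [P, hv]⟩, Subtype.ext hv⟩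
  have hker : LinearMap.ker α = LinearMap.ker β := by
    ext ⟨v, hv⟩
    have hαv : α ⟨v, hv⟩ = 0 ↔ φ v ∈ koszulRelations g := KoszulH1.mk_eq_zero
    have hβv : β ⟨v, hv⟩ = 0 ↔ f v ∈ maximalIdeal T • I :=
      (Submodule.Quotient.mk_eq_zero _).trans (Submodule.mem_smul_top_iff _ _ _)
    rw [LinearMap.mem_ker, LinearMap.mem_ker, hαv, hβv]
    constructor
    · -- lift the Koszul relation: `v` equals it up to a vector with coordinates in `I`
      intro h
      obtain ⟨w, hw, hwv⟩ := exists_mem_koszulRelations_map_eq φ hσ hg hφ h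
      have hfv : f v = f (v - w) := by
        rw [map_sub, LinearMap.mem_ker.1 (koszulRelations_le_ker f hw), sub_zero]
      rw [hfv]
      refine map_mem_of_forall_smul_mem f _ fun i e ↦ ?_
      have hi : (v - w) i ∈ I := by
        rw [RingHom.mem_ker, Pi.sub_apply, map_sub, sub_eq_zero]
        exact (congrFun hwv i).symm
      rw [show (v - w) i • f e = f e • (v - w) i from mul_comm _ _]
      have he : f e ∈ maximalIdeal T := by
        rw [← hfm]
        exact LinearMap.mem_range_self f e
      exact Submodule.smul_mem_smul he hi
    · -- `f v = f w` for some `w` with coordinates in `I`, and the syzygy `v - w` is Koszul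
      intro h
      have hle : maximalIdeal T • I ≤ (LinearMap.ker φ).map f := by
        refine Submodule.smul_le.2 fun a ha b hb ↦ ?_
        rw [← hfm] at ha
        obtain ⟨u, rfl⟩ := ha
        refine ⟨b • u, ?_, by simp [mul_comm]⟩
        rw [SetLike.mem_coe, LinearMap.mem_ker, map_smulₛₗ, RingHom.mem_ker.1 hb, zero_smul]
      obtain ⟨w, hw, hwv⟩ := hle h
      have := map_mem_koszulRelations φ hg (hy' (x := v - w) (by simp [f, hwv]))
      rwa [map_sub, LinearMap.mem_ker.1 hw, sub_zero] at this
  rw [← length_quotient_ker_of_surjective hσ α hα, hker,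
    (β.quotKerEquivOfSurjective hβ).length_eq,
    length_quotient_maximalIdeal_smul I (IsNoetherian.noetherian _), leastNumGens,
    Submodule.spanFinrank_top]

end Quotient

/-! ### Comparison with the Koszul complex -/

/-- The embedding `ι` of `Aⁿ` into its exterior algebra identifies syzygies with cycles of degree
one and, as `d (ι u * ι v) = ι (f u • v - f v • u)`, Koszul relations with boundaries. -/
theorem leastNumGens_koszulHomology_one {A : Type*} [CommRing A] {n : ℕ} (x : Fin n → A) :
    leastNumGens A (Koszul.Homology x 1) =
      leastNumGens A (KoszulH1 (Fintype.linearCombination A x)) := by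
  set f := Fintype.linearCombination A x
  have hdι (v : Fin n → A) :
      Koszul.differential x (ExteriorAlgebra.ι A v) = algebraMap A _ (f v) :=
    CliffordAlgebra.contractLeft_ι _ _ _
  have hinj : Function.Injective (ExteriorAlgebra.ι A : (Fin n → A) →ₗ[A] _) :=
    ExteriorAlgebra.ι_leftInverse.injective
  have h1 : ⋀[A]^1 (Fin n → A) = LinearMap.range (ExteriorAlgebra.ι A) := pow_one _
  have hcyc : Koszul.cycles x 1 = (LinearMap.ker f).map (ExteriorAlgebra.ι A) := by
    rw [Koszul.cycles, h1]
    ext b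
    constructor
    · rintro ⟨⟨v, rfl⟩, hv⟩
      refine ⟨v, ?_, rfl⟩
      have hv : Koszul.differential x (ExteriorAlgebra.ι A v) = 0 := hv
      rw [hdι] at hv
      exact ExteriorAlgebra.algebraMap_leftInverse _ |>.injective (hv.trans (map_zero _).symm)
    · rintro ⟨v, hv, rfl⟩
      exact ⟨⟨v, rfl⟩, (hdι v).trans (by rw [show f v = 0 from hv, map_zero])⟩
  have hbd : Koszul.boundaries x 1 = (koszulRelations f).map (ExteriorAlgebra.ι A) := by
    have hmul (u v : Fin n → A) : Koszul.differential x
        (ExteriorAlgebra.ι A u * ExteriorAlgebra.ι A v) =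
          ExteriorAlgebra.ι A (f u • v - f v • u) := by
      rw [Koszul.differential_ι_mul, hdι, ← Algebra.commutes, ← Algebra.smul_def, map_sub,
        map_smul, map_smul]
      rfl
    rw [Koszul.boundaries, Koszul.exteriorPower_succ, h1, LinearMap.range_eq_map,
      ← Submodule.span_univ, Submodule.map_span, Submodule.span_mul_span, Submodule.map_span,
      koszulRelations, Submodule.map_span]
    congr 1
    ext b
    simp only [Set.mem_image, Set.mem_mul]
    constructor
    · rintro ⟨_, ⟨_, ⟨u, -, rfl⟩, _, ⟨v, -, rfl⟩, rfl⟩, rfl⟩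
      exact ⟨_, ⟨u, v, rfl⟩, (hmul u v).symm⟩
    · rintro ⟨_, ⟨u, v, rfl⟩, rfl⟩
      exact ⟨_, ⟨_, ⟨u, trivial, rfl⟩, _, ⟨v, trivial, rfl⟩, rfl⟩, hmul u v⟩
  let e₀ : LinearMap.ker f ≃ₗ[A] Koszul.cycles x 1 :=
    (Submodule.equivMapOfInjective _ hinj _).trans (LinearEquiv.ofEq _ _ hcyc.symm)
  have he : KoszulH1 f ≃ₗ[A] Koszul.Homology x 1 := Submodule.Quotient.equiv _ _ e₀ (by
    ext ⟨b, hb⟩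
    simp only [Submodule.mem_map, Submodule.submoduleOf, Submodule.mem_comap,
      Submodule.subtype_apply, hbd]
    constructor
    · rintro ⟨v, hv, hvb⟩
      exact ⟨v, hv, congrArg Subtype.val hvb⟩
    · rintro ⟨v, hv, hvb⟩
      exact ⟨⟨v, koszulRelations_le_ker f hv⟩, hv, Subtype.ext hvb⟩)
  rw [leastNumGens, leastNumGens, Submodule.spanFinrank, Submodule.spanFinrank,
    Submodule.spanRank_eq_of_equiv he]

/-! ### Regular local rings -/

theorem comap_maximalIdeal_of_surjective {R S : Type*} [CommRing R] [CommRing S] [IsLocalRing R]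
    [IsLocalRing S] {f : R →+* S} (hf : Function.Surjective f) :
    (maximalIdeal S).comap f = maximalIdeal R :=
  have := Ideal.comap_isMaximal_of_surjective f hf (K := maximalIdeal S)
  eq_maximalIdeal this

theorem map_maximalIdeal_of_surjective {R S : Type*} [CommRing R] [CommRing S] [IsLocalRing R]
    [IsLocalRing S] {f : R →+* S} (hf : Function.Surjective f) :
    (maximalIdeal R).map f = maximalIdeal S := by
  rw [← comap_maximalIdeal_of_surjective hf, Ideal.map_comap_of_surjective f hf]

/-- Killing an element of `𝔪 \ 𝔪²` lowers the embedding dimension, as the class of this element lies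
in the kernel of the map of cotangent spaces. -/
theorem spanFinrank_maximalIdeal_lt_of_surjective {R S : Type*} [CommRing R] [CommRing S]
    [IsLocalRing R] [IsNoetherianRing R] [IsLocalRing S] [IsNoetherianRing S] {f : R →+* S}
    (hf : Function.Surjective f) {x : R} (hx : x ∈ maximalIdeal R) (hx2 : x ∉ maximalIdeal R ^ 2)
    (hfx : f x = 0) : (maximalIdeal S).spanFinrank < (maximalIdeal R).spanFinrank := by
  have hmem (a : R) : a ∈ maximalIdeal R ↔ f a ∈ maximalIdeal S := by
    rw [← comap_maximalIdeal_of_surjective hf, Ideal.mem_comap]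
  let α₀ : maximalIdeal R →ₛₗ[f] maximalIdeal S :=
    { toFun := fun a ↦ ⟨f a, (hmem a).1 a.2⟩
      map_add' := fun a b ↦ Subtype.ext (map_add f _ _)
      map_smul' := fun a b ↦ Subtype.ext (map_mul f _ _) }
  let α : (maximalIdeal R ⧸ maximalIdeal R • (⊤ : Submodule R (maximalIdeal R))) →ₛₗ[f]
      (maximalIdeal S ⧸ maximalIdeal S • (⊤ : Submodule S (maximalIdeal S))) :=
    Submodule.mapQ _ _ α₀ (Submodule.smul_le.2 fun a ha b _ ↦ by
      rw [Submodule.mem_comap, map_smulₛₗ]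
      exact Submodule.smul_mem_smul ((hmem a).1 ha) trivial)
  have hα : Function.Surjective α := by
    intro c
    obtain ⟨⟨b, hb⟩, rfl⟩ := Submodule.mkQ_surjective _ c
    obtain ⟨a, rfl⟩ := hf b
    exact ⟨Submodule.mkQ _ ⟨a, (hmem a).2 hb⟩, rfl⟩
  have hker : Nontrivial (LinearMap.ker α) := by
    let c := Submodule.mkQ (maximalIdeal R • (⊤ : Submodule R (maximalIdeal R))) ⟨x, hx⟩
    have hc : c ∈ LinearMap.ker α := by
      change Submodule.mkQ _ (α₀ ⟨x, hx⟩) = 0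
      rw [show α₀ ⟨x, hx⟩ = 0 from Subtype.ext hfx, map_zero]
    refine ⟨⟨c, hc⟩, 0, fun h ↦ hx2 ?_⟩
    have h0 : c = 0 := congrArg Subtype.val h
    rw [pow_two]
    exact (Submodule.mem_smul_top_iff _ _ _).1 ((Submodule.Quotient.mk_eq_zero _).1 h0)
  have hlen := length_eq_length_ker_add hf α hα
  rw [length_quotient_maximalIdeal_smul _ (IsNoetherian.noetherian _),
    length_quotient_maximalIdeal_smul _ (IsNoetherian.noetherian _)] at hlen
  have h1 : 1 ≤ Module.length R (LinearMap.ker α) :=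
    Order.one_le_iff_pos.2 Module.length_pos
  have : (1 + (maximalIdeal S).spanFinrank : ℕ∞) ≤ (maximalIdeal R).spanFinrank := by
    rw [hlen]
    gcongr
  have : 1 + (maximalIdeal S).spanFinrank ≤ (maximalIdeal R).spanFinrank := by exact_mod_cast this
  omega

theorem IsRegularLocalRing.quotient_span_singleton {T : Type*} [CommRing T] [IsRegularLocalRing T]
    {D : ℕ} (hD : ringKrullDim T = (D + 1 : ℕ)) {x : T} (hx : x ∈ maximalIdeal T)
    (hx2 : x ∉ maximalIdeal T ^ 2) :
    IsRegularLocalRing (T ⧸ Ideal.span {x}) ∧ ringKrullDim (T ⧸ Ideal.span {x}) = D := by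
  have hle : Ideal.span {x} ≤ maximalIdeal T := (Ideal.span_singleton_le_iff_mem _).2 hx
  have : Nontrivial (T ⧸ Ideal.span {x}) :=
    Ideal.Quotient.nontrivial_iff.2 fun h ↦
      (maximalIdeal.isMaximal T).ne_top (top_le_iff.1 (h ▸ hle))
  have : IsLocalRing (T ⧸ Ideal.span {x}) :=
    .of_surjective' (Ideal.Quotient.mk _) Ideal.Quotient.mk_surjective
  have hlt := spanFinrank_maximalIdeal_lt_of_surjective
    (Ideal.Quotient.mk_surjective (I := Ideal.span {x})) hx hx2
    (Ideal.Quotient.eq_zero_iff_mem.2 (Ideal.mem_span_singleton_self x))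
  have hT : (maximalIdeal T).spanFinrank = D + 1 := by
    have := IsRegularLocalRing.spanFinrank_maximalIdeal (R := T)
    rw [hD] at this
    exact_mod_cast this
  have hge : (D : WithBot ℕ∞) ≤ ringKrullDim (T ⧸ Ideal.span {x}) := by
    have := Ideal.height_le_ringKrullDim_quotient_add_one hx
    rw [maximalIdeal_height_eq_ringKrullDim, hD, Nat.cast_add, Nat.cast_one] at this
    exact ENat.WithBot.add_le_add_one_right_iff.1 this
  have hspan : ((maximalIdeal (T ⧸ Ideal.span {x})).spanFinrank : WithBot ℕ∞) ≤ D := by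
    exact_mod_cast (by omega)
  exact ⟨of_spanFinrank_maximalIdeal_le _ (hspan.trans hge),
    le_antisymm ((ringKrullDim_le_spanFinrank_maximalIdeal _).trans hspan) hge⟩

/-- Prime avoidance in a regular local ring of positive dimension. -/
theorem exists_notMem_sq_of_minimalPrimes {T : Type*} [CommRing T] [IsRegularLocalRing T]
    {D : ℕ} (hD : ringKrullDim T = (D + 1 : ℕ)) :
    ∃ x ∈ maximalIdeal T, x ∉ maximalIdeal T ^ 2 ∧ ∀ P ∈ minimalPrimes T, x ∉ P := by
  by_contra! h
  have hfin : (minimalPrimes T).Finite := minimalPrimes.finite_of_isNoetherianRing T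
  have hcover : (maximalIdeal T : Set T) ⊆ (id (maximalIdeal T ^ 2) : Ideal T) ∪
      (id (maximalIdeal T ^ 2) : Ideal T) ∪
      ⋃ P ∈ (hfin.toFinset : Set (Ideal T)), (id P : Ideal T) := by
    intro x hx
    by_cases hx2 : x ∈ maximalIdeal T ^ 2
    · exact .inl (.inl hx2)
    · obtain ⟨P, hP, hxP⟩ := h x hx hx2
      exact .inr (Set.mem_biUnion (hfin.mem_toFinset.2 hP) hxP)
  have hsq : ¬ maximalIdeal T ≤ maximalIdeal T ^ 2 := fun hle ↦ by
    have hbot : maximalIdeal T = ⊥ := Submodule.eq_bot_of_le_smul_of_le_jacobson_bot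
      (maximalIdeal T) _ (IsNoetherian.noetherian _) (by rwa [smul_eq_mul, ← pow_two])
      (jacobson_eq_maximalIdeal _ bot_ne_top).ge
    have := IsRegularLocalRing.spanFinrank_maximalIdeal (R := T)
    rw [hD, hbot, Submodule.spanFinrank_bot] at this
    exact absurd (by exact_mod_cast this) (Nat.succ_ne_zero D).symm
  rcases (Ideal.subset_union_prime' fun P hP ↦ (hfin.mem_toFinset.1 hP).1.1).1 hcover with
    hle | hle | ⟨P, hP, hle⟩
  · exact hsq hle
  · exact hsq hle
  · have hP := hfin.mem_toFinset.1 hP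
    have hPm : P = maximalIdeal T := le_antisymm (le_maximalIdeal hP.1.1.ne_top) hle
    have h0 := maximalIdeal_height_eq_ringKrullDim (R := T)
    rw [Ideal.height_eq_zero_iff.2 (hPm ▸ hP), hD] at h0
    exact absurd (by exact_mod_cast h0) (Nat.succ_ne_zero D).symm

/-- A minimal prime `Q` inside the prime ideal `(x)` satisfies `Q = x Q` when `x ∉ Q`, hence is zero
by Nakayama. -/
theorem isDomain_of_isDomain_quotient {T : Type*} [CommRing T] [IsLocalRing T] [IsNoetherianRing T]
    {x : T} (hx : x ∈ maximalIdeal T) (hmin : ∀ P ∈ minimalPrimes T, x ∉ P)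
    [IsDomain (T ⧸ Ideal.span {x})] : IsDomain T := by
  have hprime : (Ideal.span {x}).IsPrime := (Ideal.Quotient.isDomain_iff_prime _).1 inferInstance
  obtain ⟨Q, hQ, hQx⟩ := Ideal.exists_minimalPrimes_le (bot_le (a := Ideal.span {x}))
  have := hQ.1.1
  have hQbot : Q = ⊥ := by
    refine Submodule.eq_bot_of_le_smul_of_le_jacobson_bot (Ideal.span {x}) Q
      (IsNoetherian.noetherian _) (fun a ha ↦ ?_)
      (((Ideal.span_singleton_le_iff_mem _).2 hx).trans
        (jacobson_eq_maximalIdeal _ bot_ne_top).ge)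
    obtain ⟨t, rfl⟩ := Ideal.mem_span_singleton'.1 (hQx ha)
    rw [mul_comm]
    exact Ideal.mul_mem_mul (Ideal.mem_span_singleton_self x)
      ((this.mem_or_mem ha).resolve_right (hmin Q hQ))
  subst hQbot
  exact IsDomain.of_bot_isPrime T

/-- If the syzygies of `y` modulo the nonzero element `x` of a domain are Koszul relations, then so
are those of `(x, y)`. -/
theorem ker_linearCombination_cons_le {T : Type*} [CommRing T] [IsDomain T] {D : ℕ} {x : T}
    (hx : x ≠ 0) (y : Fin D → T)
    (hker : LinearMap.ker (linearCombination _ (Ideal.Quotient.mk (Ideal.span {x}) ∘ y)) ≤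
      koszulRelations (linearCombination _ (Ideal.Quotient.mk (Ideal.span {x}) ∘ y))) :
    LinearMap.ker (linearCombination T (Fin.cons x y : Fin (D + 1) → T)) ≤
      koszulRelations (linearCombination T (Fin.cons x y)) := by
  set f := linearCombination T (Fin.cons x y : Fin (D + 1) → T)
  set g := linearCombination T y
  have hf (v : Fin (D + 1) → T) : f v = v 0 * x + g (Fin.tail v) := by
    simp [f, g, Fintype.linearCombination_apply, Fin.sum_univ_succ, Fin.tail]
  let κ : (Fin D → T) →ₗ[T] (Fin (D + 1) → T) :=
    { toFun := fun w ↦ Fin.cons 0 w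
      map_add' := fun v w ↦ by
        ext i; refine Fin.cases ?_ (fun i ↦ ?_) i <;> simp
      map_smul' := fun a w ↦ by
        ext i; refine Fin.cases ?_ (fun i ↦ ?_) i <;> simp }
  have hκ (w) : f (κ w) = g w := by simp [hf, κ]
  intro v hv
  -- the tail of `v` is a syzygy modulo `x`, hence a Koszul relation `w` up to multiples of `x`
  have hv0 : v 0 * x + g (Fin.tail v) = 0 := (hf v).symm.trans hv
  have htail : mapCoord (Ideal.Quotient.mk (Ideal.span {x})) _ (Fin.tail v) ∈
      LinearMap.ker (linearCombination _ (Ideal.Quotient.mk (Ideal.span {x}) ∘ y)) := by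
    rw [LinearMap.mem_ker, linearCombination_mapCoord, Ideal.Quotient.eq_zero_iff_mem,
      Ideal.mem_span_singleton']
    exact ⟨-v 0, by linear_combination -hv0⟩
  obtain ⟨w, hw, hwv⟩ := exists_mem_koszulRelations_map_eq (f := g) (mapCoord _ _)
    Ideal.Quotient.mk_surjective (linearCombination_mapCoord _ y)
    (mapCoord_surjective Ideal.Quotient.mk_surjective _) (hker htail)
  have hdiv (i) : ∃ u, u * x = v i.succ - w i := by
    rw [← Ideal.mem_span_singleton', ← Ideal.Quotient.eq_zero_iff_mem, map_sub, sub_eq_zero]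
    exact (congrFun hwv i).symm
  choose u hu using hdiv
  have htail' : Fin.tail v = w + x • u := by
    ext i
    simp [Fin.tail, mul_comm x, hu]
  have hgw : g w = 0 := koszulRelations_le_ker g hw
  have hv0' : v 0 = - g u := by
    rw [htail', map_add, hgw, zero_add, map_smul, smul_eq_mul] at hv0
    exact mul_right_cancel₀ hx (by linear_combination hv0)
  -- what remains is the single Koszul relation between the first unit vector and `u`
  have hrel := smul_sub_smul_mem_koszulRelations f (Fin.cons 1 0) (κ u)
  rw [hκ, hf] at hrel
  convert! add_mem (map_mem_koszulRelations (f := g) (g := f) κ hκ hw) hrel using 1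
  ext i
  refine Fin.cases ?_ (fun i ↦ ?_) i
  · simp [κ, hv0']
  · have := congrFun htail' i
    simpa [κ, Fin.tail] using this

/-- A regular local ring of dimension `D` is a domain, and its maximal ideal has `D` generators
whose syzygies are all Koszul relations. Both are proved in one induction on `D`, since the passage
from `T ⧸ (x)` to `T` needs that `x` is not a zero divisor. -/
theorem exists_regularParameters (D : ℕ) (T : Type*) [CommRing T] [IsRegularLocalRing T]
    (hD : ringKrullDim T = D) : IsDomain T ∧ ∃ y : Fin D → T,
      Ideal.span (Set.range y) = maximalIdeal T ∧
      LinearMap.ker (linearCombination T y) ≤ koszulRelations (linearCombination T y) := by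
  induction D generalizing T with
  | zero =>
    have hm : maximalIdeal T = ⊥ := by
      have := IsRegularLocalRing.spanFinrank_maximalIdeal (R := T)
      rw [hD] at this
      exact (Submodule.spanFinrank_eq_zero_iff_eq_bot (IsNoetherian.noetherian _)).1
        (by exact_mod_cast this)
    refine ⟨(isField_iff_maximalIdeal_eq.2 hm).isDomain, Fin.elim0, by simp [hm], fun v _ ↦ ?_⟩
    rw [Subsingleton.elim v 0]
    exact zero_mem _
  | succ D ih =>
    obtain ⟨x, hx, hx2, hmin⟩ := exists_notMem_sq_of_minimalPrimes hD
    obtain ⟨_, hD'⟩ := IsRegularLocalRing.quotient_span_singleton hD hx hx2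
    obtain ⟨hdom, y', hy', hker⟩ := ih (T ⧸ Ideal.span {x}) hD'
    have := isDomain_of_isDomain_quotient hx hmin
    have hx0 : x ≠ 0 := fun h ↦ hx2 (h ▸ zero_mem _)
    obtain ⟨y, rfl⟩ : ∃ y : Fin D → T, Ideal.Quotient.mk (Ideal.span {x}) ∘ y = y' := by
      choose y hy using fun i ↦ Ideal.Quotient.mk_surjective (y' i)
      exact ⟨y, funext hy⟩
    refine ⟨this, Fin.cons x y, ?_, ker_linearCombination_cons_le hx0 y hker⟩
    rw [← comap_maximalIdeal_of_surjective (Ideal.Quotient.mk_surjective (I := Ideal.span {x})),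
      ← hy', Set.range_comp, ← Ideal.map_span,
      Ideal.comap_map_of_surjective' _ Ideal.Quotient.mk_surjective, Ideal.mk_ker, Fin.range_cons,
      Set.insert_eq, Ideal.span_union, sup_comm]

/-! ### The defect and the inequality -/

/-- The maximal ideal is the only prime ideal over the kernel. -/
theorem height_ker_of_isArtinianRing {T A : Type*} [CommRing T] [CommRing A] [IsLocalRing T]
    [IsLocalRing A] [IsArtinianRing A] {f : T →+* A} (hf : Function.Surjective f) :
    ((RingHom.ker f).height : WithBot ℕ∞) = ringKrullDim T := by
  rw [← maximalIdeal_height_eq_ringKrullDim]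
  congr 1
  refine le_antisymm (Ideal.height_mono (le_maximalIdeal (RingHom.ker_ne_top f))) ?_
  rw [Ideal.height_eq_inf_minimalPrimes (RingHom.ker f)]
  refine le_iInf₂ fun P hP ↦ ?_
  have := hP.1.1
  have := Ideal.map_isPrime_of_surjective hf hP.1.2
  have hmax := eq_maximalIdeal (IsArtinianRing.isMaximal_of_isPrime (P.map f))
  have hPm : P = maximalIdeal T := by
    rw [← comap_maximalIdeal_of_surjective hf, ← hmax, Ideal.comap_map_of_surjective' f hf,
      sup_eq_left.2 hP.1.2]
  rw [hPm]

/-- A complete intersection defect of an Artinian local ring is the length of the first Koszul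
homology of some finite family generating the maximal ideal, minus the number of its elements. -/
theorem HasCompleteIntersectionDefect.exists_eq_length_sub {A : Type*} [CommRing A] [IsLocalRing A]
    [IsArtinianRing A] {d : ℤ} (hd : HasCompleteIntersectionDefect A d) :
    ∃ (r h : ℕ) (y : Fin r → A),
      Ideal.span (Set.range y) = maximalIdeal A ∧
      Module.length A (KoszulH1 (linearCombination A y)) = h ∧ d = h - r := by
  obtain ⟨T, _, _, f, hf, rfl⟩ := hd
  obtain ⟨r, hr⟩ : ∃ r : ℕ, ringKrullDim T = r :=
    ⟨_, (IsRegularLocalRing.spanFinrank_maximalIdeal (R := T)).symm⟩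
  obtain ⟨-, y, hy, hker⟩ := exists_regularParameters r T hr
  have hht : (RingHom.ker f).height.toNat = r := by
    have := (height_ker_of_isArtinianRing hf).trans hr
    rw [show (RingHom.ker f).height = (r : ℕ∞) by exact_mod_cast this]
    rfl
  refine ⟨r, _, f ∘ y, ?_, length_koszulH1_of_presentation f hf y hy hker, by rw [hht]⟩
  rw [Set.range_comp, ← Ideal.map_span, hy, map_maximalIdeal_of_surjective hf]

theorem theorem16 {A : Type u} [CommRing A] [IsLocalRing A] [IsArtinianRing A]
    (hA : ringChar A = ringChar (IsLocalRing.ResidueField A))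
    {n : ℕ} (x : Fin n → A) (hx : ∀ i, x i ∈ IsLocalRing.maximalIdeal A) :
    (∃ d : ℤ, HasCompleteIntersectionDefect.{u, u} A d) ∧
    (∃ e : ℤ, HasCompleteIntersectionDefect.{u, u} (A ⧸ Ideal.span (Set.range x)) e) ∧
    ∀ d e : ℤ, HasCompleteIntersectionDefect.{u, v} A d →
      HasCompleteIntersectionDefect.{u, w} (A ⧸ Ideal.span (Set.range x)) e →
      (n : ℤ) + d - e ≤ (leastNumGens A (Koszul.Homology x 1) : ℤ) := by
  obtain ⟨T, _, _, f, hf⟩ := exists_surjective_of_isRegularLocalRing A hA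
  refine ⟨⟨_, T, _, inferInstance, f, hf, rfl⟩, ⟨_, T, _, inferInstance,
    (Ideal.Quotient.mk _).comp f, Ideal.Quotient.mk_surjective.comp hf, rfl⟩, fun d e hd he ↦ ?_⟩
  have hJ : Ideal.span (Set.range x) ≤ maximalIdeal A :=
    Ideal.span_le.2 (Set.range_subset_iff.2 hx)
  have : Nontrivial (A ⧸ Ideal.span (Set.range x)) :=
    Ideal.Quotient.nontrivial_iff.2 fun h ↦
      (maximalIdeal.isMaximal A).ne_top (top_le_iff.1 (h ▸ hJ))
  have : IsLocalRing (A ⧸ Ideal.span (Set.range x)) :=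
    .of_surjective' (Ideal.Quotient.mk _) Ideal.Quotient.mk_surjective
  obtain ⟨r, h, y, hy, hh, rfl⟩ := HasCompleteIntersectionDefect.exists_eq_length_sub hd
  obtain ⟨s, k, z, hz, hk, rfl⟩ := HasCompleteIntersectionDefect.exists_eq_length_sub he
  have hy' : Ideal.span (Set.range (Ideal.Quotient.mk (Ideal.span (Set.range x)) ∘ y)) =
      maximalIdeal (A ⧸ Ideal.span (Set.range x)) := by
    rw [Set.range_comp, ← Ideal.map_span, hy,
      map_maximalIdeal_of_surjective Ideal.Quotient.mk_surjective]
  have hrange {B : Type u} [CommRing B] {m : ℕ} (w : Fin m → B) :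
      LinearMap.range (linearCombination B w) = Ideal.span (Set.range w) :=
    Fintype.range_linearCombination B w
  have h1 := length_koszulH1_coprod_le x y hy
  rw [KoszulH1.length_coprod _ ((hrange y).trans hy) _ ((hrange x).trans_le hJ), hh,
    ← leastNumGens_koszulHomology_one] at h1
  have h2 := KoszulH1.length_add_eq _ ((hrange _).trans hy') _ ((hrange z).trans hz)
  rw [hk] at h2
  obtain ⟨l, hl⟩ := ENat.ne_top_iff_exists.1 (show Module.length (A ⧸ Ideal.span (Set.range x))
    (KoszulH1 (linearCombination _ (Ideal.Quotient.mk (Ideal.span (Set.range x)) ∘ y))) ≠ ⊤ from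
      Module.length_ne_top)
  rw [← hl] at h1 h2
  norm_cast at h1 h2
  omega
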